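/- Let $M$ be a compact topological space with a finite Radon (regular Borel) measure $\mu$, and let $\mathcal E$ be a Dirichlet form on $L^2(M,\mu)$ with domain $\mathcal D(\mathcal E)$: a nonnegative, symmetric bilinear form on a dense subspace $\mathcal D(\mathcal E)\subset L^2(M,\mu)$, closed (that is, $\mathcal D(\mathcal E)$ is complete for the norm $(\mathcal E(v)+\|v\|_{L^2}^2)^{1/2}$, where $\mathcal E(v)=\mathcal E(v,v)$), such that $v\in\mathcal D(\mathcal E)$ implies $|v|\in\mathcal D(\mathcal E)$ with $\mathcal E(|v|)\le\mathcal E(v)$, and $0\le v\in\mathcal D(\mathcal E)$ implies $\inf\{v,1\}\in\mathcal D(\mathcal E)$ with $\mathcal E(\inf\{v,1\})\le\mathcal E(v)$. Let $L$ be its generator. Assume that $\mathcal E$ is - regular: $\mathcal D(\mathcal E)\cap C^0(M)$ is dense in $\mathcal D(\mathcal E)$ for the norm $(\mathcal E(v)+\|v\|_{L^2}^2)^{1/2}$ and dense in $C^0(M)$ for the uniform norm; - strongly local: $\mathcal E(u,v)=0$ whenever $u,v\in\mathcal D(\mathcal E)$ and $u$ is constant in a neighbourhood of $\operatorname{supp}(v)$;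 and that there are $\nu>2$ and $A,B>0$ such that the Sobolev inequality $$\|v\|_{L^{2\nu/(\nu-2)}}^2\le A\,\mathcal E(v)+B\,\|v\|_{L^2}^2\qquad\text{for all } v\in\mathcal D(\mathcal E)$$ holds. Let $V\in L^1(M,\mu)$ be real-valued and suppose that $V_-=\max\{0,-V\}$ is infinitesimally form bounded with respect to $\mathcal E$: for every $\varepsilon>0$ there is $c(\varepsilon)$ with $$\int_M V_-v^2\,d\mu\le\varepsilon\,\mathcal E(v)+c(\varepsilon)\int_M v^2\,d\mu\qquad\text{for all } v\in\mathcal D(\mathcal E).$$ Put $\mathcal D(\mathcal E_V)=\{v\in\mathcal D(\mathcal E):\int_M Vv^2\,d\mu<\infty\}$, $\mathcal E_V(u,v)=\mathcal E(u,v)+\int_M Vuv\,d\mu$ for $u,v\in\mathcal D(\mathcal E_V)$, and $$Y(V)=\inf\{\mathcal E_V(v,v): v\in\mathcal D(\mathcal E_V),\ \|v\|_{L^{2\nu/(\nu-2)}}=1\}.$$ If $u\in\mathcal D(\mathcal E_V)$ is a nonnegative solution of $$Lu+Vu=Y(V)\,u^{\frac{\nu+2}{\nu-2}}$$ in the weak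 sense, i.e. $\mathcal E_V(u,\varphi)=Y(V)\int_M u^{\frac{\nu+2}{\nu-2}}\varphi\,d\mu$ for every $\varphi\in\mathcal D(\mathcal E_V)$, then $$\int_M u^p\,d\mu<\infty\qquad\text{for every } p\ge 2.$$ -/

import Mathlib

open MeasureTheory Filter Topology

namespace DirichletYamabe

/-- A nonnegative closed symmetric bilinear form on a dense subspace of `L²(M, μ)`. -/
structure ClosedSymmetricForm {M : Type*} [MeasurableSpace M] (μ : Measure M) where
  /-- The domain `𝒟(ℰ)`. -/
  domain : Submodule ℝ (Lp ℝ 2 μ)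
  /-- The bilinear form `ℰ : 𝒟(ℰ) × 𝒟(ℰ) → ℝ`. -/
  form : LinearMap.BilinForm ℝ domain
  dense_domain : Dense (domain : Set (Lp ℝ 2 μ))
  symm : ∀ u v : domain, form u v = form v u
  nonneg : ∀ v : domain, 0 ≤ form v v
  /-- Closedness: `𝒟(ℰ)` is complete for the norm `(ℰ(v) + ‖v‖²)^{1/2}`. -/
  closed : ∀ s : ℕ → domain,
    (∀ ε : ℝ, 0 < ε → ∃ N : ℕ, ∀ m n : ℕ, N ≤ m → N ≤ n →
      form (s m - s n) (s m - s n) + ‖s m - s n‖ ^ 2 < ε) →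
    ∃ u : domain,
      Tendsto (fun n => form (s n - u) (s n - u) + ‖s n - u‖ ^ 2) atTop (𝓝 0)

/-- A Dirichlet form on `L²(M, μ)`, `μ` finite: a closed symmetric form that has the two
Beurling-Deny contraction properties. -/
structure DirichletForm {M : Type*} [MeasurableSpace M] (μ : Measure M) [IsFiniteMeasure μ]
    extends ClosedSymmetricForm μ where
  /-- `|v| ∈ 𝒟(ℰ)` and `ℰ(|v|) ≤ ℰ(v)` for `v ∈ 𝒟(ℰ)`. -/
  abs_contraction : ∀ v : domain, ∃ h : |(v : Lp ℝ 2 μ)| ∈ domain,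
    form ⟨|(v : Lp ℝ 2 μ)|, h⟩ ⟨|(v : Lp ℝ 2 μ)|, h⟩ ≤ form v v
  /-- `inf {v, 1} ∈ 𝒟(ℰ)` and `ℰ(inf {v, 1}) ≤ ℰ(v)` for `0 ≤ v ∈ 𝒟(ℰ)`. -/
  inf_one_contraction : ∀ v : domain, 0 ≤ (v : Lp ℝ 2 μ) →
    ∃ h : (v : Lp ℝ 2 μ) ⊓ Lp.const 2 μ (1 : ℝ) ∈ domain,
      form ⟨(v : Lp ℝ 2 μ) ⊓ Lp.const 2 μ (1 : ℝ), h⟩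
        ⟨(v : Lp ℝ 2 μ) ⊓ Lp.const 2 μ (1 : ℝ), h⟩ ≤ form v v

/-- The support of (the class of) a function `v`: the complement of the union of all open sets on
which `v` vanishes almost everywhere. -/
def essSupport {M : Type*} [MeasurableSpace M] [TopologicalSpace M] (μ : Measure M)
    (v : M → ℝ) : Set M :=
  {x | ∀ U : Set M, IsOpen U → x ∈ U → ¬ (∀ᵐ y ∂μ, y ∈ U → v y = 0)}

namespace DirichletForm

/-- Regularity: `𝒟(ℰ) ∩ C⁰(M)` is dense in `𝒟(ℰ)` for the norm `(ℰ(v) + ‖v‖²)^{1/2}`, and dense in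
`C⁰(M)` for the uniform norm. -/
structure IsRegular {M : Type*} [TopologicalSpace M] [CompactSpace M] [MeasurableSpace M]
    [BorelSpace M] {μ : Measure M} [IsFiniteMeasure μ] (E : DirichletForm μ) : Prop where
  dense_in_domain : ∀ v : E.domain, ∀ ε : ℝ, 0 < ε →
    ∃ w : E.domain, (∃ f : C(M, ℝ), (w : Lp ℝ 2 μ) = ContinuousMap.toLp 2 μ ℝ f) ∧
      E.form (v - w) (v - w) + ‖v - w‖ ^ 2 < ε
  dense_in_continuous : Dense {f : C(M, ℝ) | ContinuousMap.toLp 2 μ ℝ f ∈ E.domain}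

/-- Strong locality: `ℰ(u, v) = 0` if `u` is constant in a neighbourhood of the support of `v`. -/
def IsStronglyLocal {M : Type*} [TopologicalSpace M] [MeasurableSpace M]
    {μ : Measure M} [IsFiniteMeasure μ] (E : DirichletForm μ) : Prop :=
  ∀ u v : E.domain,
    (∃ U : Set M, IsOpen U ∧ essSupport μ ((v : Lp ℝ 2 μ) : M → ℝ) ⊆ U ∧
      ∃ c : ℝ, ∀ᵐ y ∂μ, y ∈ U → ((u : Lp ℝ 2 μ) : M → ℝ) y = c) →
    E.form u v = 0

variable {M : Type*} [MeasurableSpace M] {μ : Measure M} [IsFiniteMeasure μ]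

/-- The Sobolev inequality `‖v‖²_{L^{2ν/(ν-2)}} ≤ A ℰ(v) + B ‖v‖²_{L²}` on `𝒟(ℰ)`; in particular
`𝒟(ℰ) ⊆ L^{2ν/(ν-2)}`. -/
def SobolevInequality (E : DirichletForm μ) (ν A B : ℝ) : Prop :=
  ∀ v : E.domain,
    eLpNorm ((v : Lp ℝ 2 μ) : M → ℝ) (ENNReal.ofReal (2 * ν / (ν - 2))) μ ^ 2
      ≤ ENNReal.ofReal (A * E.form v v + B * ‖v‖ ^ 2)

/-- A nonnegative function `W` is infinitesimally form bounded with respect to `ℰ`: for every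
`ε > 0` there is `c` with `∫ W v² dμ ≤ ε ℰ(v) + c ∫ v² dμ` for all `v ∈ 𝒟(ℰ)`. -/
def InfinitesimallyFormBounded (E : DirichletForm μ) (W : M → ℝ) : Prop :=
  ∀ ε : ℝ, 0 < ε → ∃ c : ℝ, 0 ≤ c ∧ ∀ v : E.domain,
    ∫⁻ x, ENNReal.ofReal (W x * ((v : Lp ℝ 2 μ) : M → ℝ) x ^ 2) ∂μ
      ≤ ENNReal.ofReal (ε * E.form v v + c * ‖v‖ ^ 2)

/-- The domain `𝒟(ℰ_V)`: those `v ∈ 𝒟(ℰ)` with `∫ V v² dμ` finite. -/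
def schrodingerDomain (E : DirichletForm μ) (V : M → ℝ) : Set E.domain :=
  {v | Integrable (fun x => V x * ((v : Lp ℝ 2 μ) : M → ℝ) x ^ 2) μ}

/-- The form `ℰ_V(u, v) = ℰ(u, v) + ∫ V u v dμ`, to be used on `𝒟(ℰ_V)`. -/
noncomputable def schrodingerForm (E : DirichletForm μ) (V : M → ℝ) (u v : E.domain) : ℝ :=
  E.form u v + ∫ x, V x * ((u : Lp ℝ 2 μ) : M → ℝ) x * ((v : Lp ℝ 2 μ) : M → ℝ) x ∂μ

/-- The Yamabe invariant `Y(V)`: the infimum of `ℰ_V(v)` over all `v` with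
`‖v‖_{L^{2ν/(ν-2)}} = 1`. Elements of `𝒟(ℰ)` outside `𝒟(ℰ_V)` have `ℰ_V(v) = +∞` and
do not matter for the infimum. -/
noncomputable def yamabeInvariant (E : DirichletForm μ) (V : M → ℝ) (ν : ℝ) : ℝ :=
  sInf {r : ℝ | ∃ v ∈ E.schrodingerDomain V,
    eLpNorm ((v : Lp ℝ 2 μ) : M → ℝ) (ENNReal.ofReal (2 * ν / (ν - 2))) μ = 1 ∧
      r = E.schrodingerForm V v v}

/-- `u ∈ 𝒟(ℰ_V)` is a nonnegative (weak) solution of `L u + V u = Y(V) u^{(ν+2)/(ν-2)}`, where `L`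
is the generator of `ℰ`. -/
structure IsNonnegYamabeSolution (E : DirichletForm μ) (V : M → ℝ) (ν : ℝ) (u : E.domain) :
    Prop where
  mem_domain : u ∈ E.schrodingerDomain V
  nonneg : 0 ≤ (u : Lp ℝ 2 μ)
  weak_eq : ∀ φ ∈ E.schrodingerDomain V,
    E.schrodingerForm V u φ = E.yamabeInvariant V ν *
      ∫ x, ((u : Lp ℝ 2 μ) : M → ℝ) x ^ ((ν + 2) / (ν - 2)) * ((φ : Lp ℝ 2 μ) : M → ℝ) x ∂μ

end DirichletForm

end DirichletYamabe

/-! The proof is a Moser iteration: from `u ∈ L^{2γ}` with `γ ≥ 1` one derives `u ∈ L^{2γσ}`, where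
`σ = ν/(ν-2) > 1`. Starting at `u ∈ L²`, iteration passes every exponent, and `μ` is finite.

A chain rule would test the equation with `φ(u)` and compare with `ψ(u)`, where `φ' = ψ'²` and `ψ(t)
~ t^γ`. Here `ψ` and `φ` are piecewise linear: `u` is cut at the dyadic levels `2^i - 1` into layers
`a_i`, and `w = ∑ s_i a_i`, `φ = ∑ s_i² a_i` with `s_i = 2^{βi}`, `β = γ - 1`. A layer is nonzero
only where all lower layers are full. Truncation therefore gives `ℰ(a_i, a_j) ≥ 0` for `i ≠ j`
(`form_nonneg_of_layers`), and algebra turns this into `ℰ(w) ≤ ℰ(u, φ)` (`form_sum_smul_le`,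
`exists_layerSum`).

The equation evaluates `ℰ(u, φ)`. As `u φ ≤ C w²`, the potential costs at most `C ∫ V₋ w²`,
controlled by form boundedness. The nonlinearity costs at most `|Y| C ∫ u^q w²` with `q = 4/(ν-2)`;
since `u ∈ L^{2+q}`, the factor `u^q` is a bounded part plus a part small in `L^{(2+q)/q}`, and
Sobolev controls the latter. Both energy terms are absorbed, so `‖w‖²_{2ν/(ν-2)} ≤ K ‖w‖₂²` with `K`
independent of the number of layers (`exists_eLpNorm_le`). Letting that number tend to infinity,
Fatou's lemma gives the step (`memLp_step`). -/

namespace DirichletYamabe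

/-! ### Piecewise linear substitutes for powers -/

/-- The convex piecewise linear function on `[0, ∞)` with slope `s i` between `2 ^ i - 1` and
`2 ^ (i + 1) - 1` for `i < n`, and slope `s n` beyond `2 ^ n - 1`. -/
noncomputable def layerSum (s : ℕ → ℝ) (n : ℕ) (t : ℝ) : ℝ :=
  ∑ i ∈ Finset.range n, s i * (min t (2 ^ (i + 1) - 1) - min t (2 ^ i - 1)) +
    s n * (t - min t (2 ^ n - 1))

theorem layerSum_zero (s : ℕ → ℝ) {t : ℝ} (ht : 0 ≤ t) : layerSum s 0 t = s 0 * t := by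
  simp [layerSum, ht]

/-- One more layer changes the function only beyond the new breakpoint. The inductions on `n` below
rest on this: under the breakpoint nothing happens, beyond it crude linear bounds suffice. -/
theorem layerSum_succ (s : ℕ → ℝ) (n : ℕ) (t : ℝ) :
    layerSum s (n + 1) t =
      layerSum s n t + (s (n + 1) - s n) * (t - min t (2 ^ (n + 1) - 1)) := by
  simp only [layerSum, Finset.sum_range_succ]
  ring

theorem layerSum_succ_of_le (s : ℕ → ℝ) {n : ℕ} {t : ℝ} (ht : t ≤ 2 ^ (n + 1) - 1) :
    layerSum s (n + 1) t = layerSum s n t := by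
  rw [layerSum_succ, min_eq_left ht]; ring

theorem layerSum_nonneg {s : ℕ → ℝ} (hs : ∀ i, 0 ≤ s i) (hm : Monotone s) (n : ℕ) {t : ℝ}
    (ht : 0 ≤ t) : 0 ≤ layerSum s n t := by
  induction n with
  | zero => rw [layerSum_zero s ht]; exact mul_nonneg (hs 0) ht
  | succ n ih =>
    rw [layerSum_succ]
    have h1 : 0 ≤ s (n + 1) - s n := sub_nonneg.2 (hm n.le_succ)
    have h2 : 0 ≤ t - min t (2 ^ (n + 1) - 1) := sub_nonneg.2 (min_le_left _ _)
    positivity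

theorem layerSum_le {s : ℕ → ℝ} (hm : Monotone s) (n : ℕ) {t : ℝ}
    (ht : 0 ≤ t) : layerSum s n t ≤ s n * t := by
  induction n with
  | zero => rw [layerSum_zero s ht]
  | succ n ih =>
    rw [layerSum_succ]
    have h1 : 0 ≤ s (n + 1) - s n := sub_nonneg.2 (hm n.le_succ)
    have h2 : t - min t (2 ^ (n + 1) - 1) ≤ t := by
      have : (0 : ℝ) ≤ min t (2 ^ (n + 1) - 1) :=
        le_min ht (sub_nonneg.2 (one_le_pow₀ one_le_two))
      linarith
    nlinarith [mul_le_mul_of_nonneg_left h2 h1]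

/-- For such `t` one has `2 (2^n - 1) ≤ t`, so at least half of `[0, t]` lies above the breakpoint
`2^n - 1`, where the slope is at least `s n`. -/
theorem le_layerSum_succ {s : ℕ → ℝ} (hs : ∀ i, 0 ≤ s i) (hm : Monotone s) (n : ℕ) {t : ℝ}
    (ht : 2 ^ (n + 1) - 1 ≤ t) : s n * t / 2 ≤ layerSum s (n + 1) t := by
  have h0 : (1 : ℝ) ≤ 2 ^ n := one_le_pow₀ one_le_two
  have hp : (2 : ℝ) ^ (n + 1) = 2 * 2 ^ n := by ring
  have ht' : (2 : ℝ) ^ n - 1 ≤ t := by linarith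
  have hsum : 0 ≤ ∑ i ∈ Finset.range n,
      s i * (min t (2 ^ (i + 1) - 1) - min t (2 ^ i - 1)) := by
    refine Finset.sum_nonneg fun i _ => mul_nonneg (hs i) (sub_nonneg.2 ?_)
    refine min_le_min_left _ (sub_le_sub_right (pow_le_pow_right₀ one_le_two i.le_succ) _)
  have h1 : s n ≤ s (n + 1) := hm n.le_succ
  have h2 := hs n
  rw [layerSum, Finset.sum_range_succ, min_eq_right ht, min_eq_right ht']
  have h3 : s n * (t - (2 ^ (n + 1) - 1)) ≤ s (n + 1) * (t - (2 ^ (n + 1) - 1)) :=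
    mul_le_mul_of_nonneg_right h1 (sub_nonneg.2 ht)
  have h4 : s n * t / 2 ≤ s n * (t - (2 ^ n - 1)) := by
    have : s n * (t / 2) ≤ s n * (t - (2 ^ n - 1)) := by
      apply mul_le_mul_of_nonneg_left _ h2
      linarith
    linarith
  nlinarith

/-- The dyadic slopes `2 ^ (β i)`. -/
noncomputable def dyadicSlope (β : ℝ) (i : ℕ) : ℝ := ((2 : ℝ) ^ i) ^ β

theorem dyadicSlope_pos (β : ℝ) (i : ℕ) : 0 < dyadicSlope β i := by
  unfold dyadicSlope; positivity

theorem dyadicSlope_mono {β : ℝ} (hβ : 0 ≤ β) : Monotone (dyadicSlope β) := fun _ _ h =>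
  Real.rpow_le_rpow (by positivity) (pow_le_pow_right₀ one_le_two h) hβ

theorem dyadicSlope_zero (β : ℝ) : dyadicSlope β 0 = 1 := by simp [dyadicSlope]

theorem dyadicSlope_succ (β : ℝ) (n : ℕ) :
    dyadicSlope β (n + 1) = 2 ^ β * dyadicSlope β n := by
  rw [dyadicSlope, dyadicSlope, pow_succ', Real.mul_rpow (by norm_num) (by positivity)]

/-- This is `t φ(t) ≤ C ψ(t)²` with `C` independent of `n`. The factor `4` is the squared loss of
`le_layerSum_succ`, and `(2^β)²` the squared ratio of consecutive slopes. -/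
theorem mul_layerSum_sq_le {β : ℝ} (hβ : 0 ≤ β) (n : ℕ) {t : ℝ} (ht : 0 ≤ t) :
    t * layerSum (fun i => dyadicSlope β i ^ 2) n t
      ≤ 4 * (2 ^ β) ^ 2 * layerSum (dyadicSlope β) n t ^ 2 := by
  have hb : (1 : ℝ) ≤ 2 ^ β := Real.one_le_rpow one_le_two hβ
  have hm2 : Monotone fun i => dyadicSlope β i ^ 2 := fun i j h =>
    pow_le_pow_left₀ (dyadicSlope_pos β i).le (dyadicSlope_mono hβ h) 2
  induction n with
  | zero =>
    rw [layerSum_zero _ ht, layerSum_zero _ ht, dyadicSlope_zero]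
    nlinarith [sq_nonneg t, mul_nonneg (sq_nonneg t) (sub_nonneg.2 hb)]
  | succ n ih =>
    rcases le_total t (2 ^ (n + 1) - 1) with h | h
    · rwa [layerSum_succ_of_le _ h, layerSum_succ_of_le _ h]
    · have h1 := le_layerSum_succ (fun i => (dyadicSlope_pos β i).le) (dyadicSlope_mono hβ) n h
      have h2 := layerSum_le hm2 (n + 1) ht
      have h0 : 0 ≤ dyadicSlope β n * t / 2 := by
        have := dyadicSlope_pos β n
        positivity
      calc _ ≤ t * (dyadicSlope β (n + 1) ^ 2 * t) := mul_le_mul_of_nonneg_left h2 ht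
        _ = 4 * (2 ^ β) ^ 2 * (dyadicSlope β n * t / 2) ^ 2 := by rw [dyadicSlope_succ]; ring
        _ ≤ _ := by gcongr

/-- The lower bound that survives `n → ∞`: its left side increases to `t (t/2)^β`, a multiple of
`t^{β+1}`. -/
theorem mul_rpow_le_layerSum {β : ℝ} (hβ : 0 ≤ β) (n : ℕ) {t : ℝ} (ht : 0 ≤ t) :
    t * (min t (2 ^ (n + 1) - 1) / 2) ^ β ≤ 2 * 2 ^ β * layerSum (dyadicSlope β) n t := by
  have hb : (1 : ℝ) ≤ 2 ^ β := Real.one_le_rpow one_le_two hβ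
  have hmin (k : ℕ) : (0 : ℝ) ≤ min t (2 ^ k - 1) :=
    le_min ht (sub_nonneg.2 (one_le_pow₀ one_le_two))
  induction n with
  | zero =>
    rw [layerSum_zero _ ht, dyadicSlope_zero]
    have h1 : min t (2 ^ (0 + 1) - 1) ≤ 1 := (min_le_right _ _).trans (by norm_num)
    have h2 : (min t (2 ^ (0 + 1) - 1) / 2) ^ β ≤ 1 :=
      Real.rpow_le_one (div_nonneg (hmin _) zero_le_two)
        ((div_le_one two_pos).2 (h1.trans one_le_two)) hβ
    nlinarith [mul_le_mul_of_nonneg_left h2 ht, mul_le_mul_of_nonneg_right hb ht]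
  | succ n ih =>
    rcases le_total t (2 ^ (n + 1) - 1) with h | h
    · rw [layerSum_succ_of_le _ h]
      rw [min_eq_left h] at ih
      rwa [min_eq_left (h.trans (sub_le_sub_right (pow_le_pow_right₀ one_le_two (by lia)) _))]
    · have h1 := le_layerSum_succ (fun i => (dyadicSlope_pos β i).le) (dyadicSlope_mono hβ) n h
      have h2 : (min t (2 ^ (n + 1 + 1) - 1) / 2) ^ β ≤ dyadicSlope β (n + 1) := by
        refine Real.rpow_le_rpow (div_nonneg (hmin _) zero_le_two) ?_ hβ
        have := min_le_right t (2 ^ (n + 1 + 1) - 1)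
        have hp : (2 : ℝ) ^ (n + 1 + 1) = 2 * 2 ^ (n + 1) := by ring
        linarith
      calc _ ≤ t * dyadicSlope β (n + 1) := mul_le_mul_of_nonneg_left h2 ht
        _ = 2 * 2 ^ β * (dyadicSlope β n * t / 2) := by rw [dyadicSlope_succ]; ring
        _ ≤ _ := by gcongr

/-- The upper bound, uniform in `n`, that makes the `L²` norms of the test functions bounded. The
summand `t` is there for small `t`, where the slope is `1` and `t^β` is small. -/
theorem layerSum_le_rpow {β : ℝ} (hβ : 0 ≤ β) (n : ℕ) {t : ℝ} (ht : 0 ≤ t) :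
    layerSum (dyadicSlope β) n t ≤ 2 ^ β * (t + t ^ (β + 1)) := by
  have hb : (1 : ℝ) ≤ 2 ^ β := Real.one_le_rpow one_le_two hβ
  have hg : 0 ≤ t ^ (β + 1) := Real.rpow_nonneg ht _
  induction n with
  | zero =>
    rw [layerSum_zero _ ht, dyadicSlope_zero]
    nlinarith [mul_le_mul_of_nonneg_right hb ht, mul_nonneg (zero_le_one.trans hb) hg]
  | succ n ih =>
    rcases le_total t (2 ^ (n + 1) - 1) with h | h
    · rwa [layerSum_succ_of_le _ h]
    · have h0 : (1 : ℝ) ≤ 2 ^ n := one_le_pow₀ one_le_two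
      have hp : (2 : ℝ) ^ (n + 1) = 2 * 2 ^ n := by ring
      have hn : (2 : ℝ) ^ n ≤ t := by linarith
      have ht0 : 0 < t := by linarith
      calc _ ≤ dyadicSlope β (n + 1) * t := layerSum_le (dyadicSlope_mono hβ) _ ht
        _ = 2 ^ β * (dyadicSlope β n * t) := by rw [dyadicSlope_succ]; ring
        _ ≤ 2 ^ β * (t ^ β * t) := by
          have : dyadicSlope β n ≤ t ^ β := Real.rpow_le_rpow (by positivity) hn hβ
          gcongr
        _ = 2 ^ β * t ^ (β + 1) := by rw [Real.rpow_add_one ht0.ne']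
        _ ≤ _ := by gcongr; linarith

/-! ### The energy inequality from truncation -/

/-- If the off-diagonal entries of a symmetric form on a family are nonnegative, then testing the
sum against the squared weights dominates the energy of the weighted sum. -/
theorem form_sum_smul_le {D : Type*} [AddCommGroup D] [Module ℝ D] (F : LinearMap.BilinForm ℝ D)
    (hF : ∀ x y, F x y = F y x) (S : Finset ℕ) (a : ℕ → D) (s : ℕ → ℝ)
    (ha : ∀ i ∈ S, ∀ j ∈ S, i < j → 0 ≤ F (a i) (a j)) :
    F (∑ i ∈ S, s i • a i) (∑ i ∈ S, s i • a i)
      ≤ F (∑ i ∈ S, a i) (∑ i ∈ S, s i ^ 2 • a i) := by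
  have hneg : ∀ i ∈ S, ∀ j ∈ S, 0 ≤ (s i - s j) ^ 2 * F (a i) (a j) := by
    intro i hi j hj
    rcases lt_trichotomy i j with h | rfl | h
    · exact mul_nonneg (sq_nonneg _) (ha i hi j hj h)
    · simp
    · exact mul_nonneg (sq_nonneg _) (hF _ _ ▸ ha j hj i hi h)
  have h1 : F (∑ i ∈ S, s i • a i) (∑ i ∈ S, s i • a i)
      = ∑ i ∈ S, ∑ j ∈ S, s i * s j * F (a i) (a j) := by
    simp only [map_sum, LinearMap.sum_apply, map_smul, LinearMap.smul_apply, smul_eq_mul,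
      Finset.mul_sum]
    rw [Finset.sum_comm]
    exact Finset.sum_congr rfl fun i _ => Finset.sum_congr rfl fun j _ => by ring
  have h2 : F (∑ i ∈ S, a i) (∑ i ∈ S, s i ^ 2 • a i)
      = ∑ i ∈ S, ∑ j ∈ S, s j ^ 2 * F (a i) (a j) := by
    simp only [map_sum, LinearMap.sum_apply, map_smul, smul_eq_mul, Finset.mul_sum]
    rw [Finset.sum_comm]
  have h3 : F (∑ i ∈ S, a i) (∑ i ∈ S, s i ^ 2 • a i)
      = ∑ i ∈ S, ∑ j ∈ S, s i ^ 2 * F (a i) (a j) := by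
    rw [h2, Finset.sum_comm]
    exact Finset.sum_congr rfl fun i _ => Finset.sum_congr rfl fun j _ => by rw [hF]
  have h4 : 0 ≤ ∑ i ∈ S, ∑ j ∈ S, (s i - s j) ^ 2 * F (a i) (a j) :=
    Finset.sum_nonneg fun i hi => Finset.sum_nonneg fun j hj => hneg i hi j hj
  -- By symmetry the two sides of the claim differ by half of this nonnegative double sum.
  have h5 : ∑ i ∈ S, ∑ j ∈ S, (s i - s j) ^ 2 * F (a i) (a j)
      = (∑ i ∈ S, ∑ j ∈ S, s i ^ 2 * F (a i) (a j)
        + ∑ i ∈ S, ∑ j ∈ S, s j ^ 2 * F (a i) (a j))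
        - 2 * ∑ i ∈ S, ∑ j ∈ S, s i * s j * F (a i) (a j) := by
    simp only [Finset.mul_sum, ← Finset.sum_add_distrib, ← Finset.sum_sub_distrib]
    exact Finset.sum_congr rfl fun i _ => Finset.sum_congr rfl fun j _ => by ring
  linarith

namespace DirichletForm

variable {M : Type*} [MeasurableSpace M] {μ : Measure M} [IsFiniteMeasure μ]

theorem coeFn_sum_smul (E : DirichletForm μ) (S : Finset ℕ) (s : ℕ → ℝ) (a : ℕ → E.domain)
    (f : ℕ → M → ℝ) (ha : ∀ i ∈ S, ((a i : Lp ℝ 2 μ) : M → ℝ) =ᵐ[μ] f i) :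
    (((∑ i ∈ S, s i • a i : E.domain) : Lp ℝ 2 μ) : M → ℝ)
      =ᵐ[μ] fun x => ∑ i ∈ S, s i * f i x := by
  induction S using Finset.induction_on with
  | empty =>
    simp only [Finset.sum_empty]
    exact Lp.coeFn_zero ℝ 2 μ
  | insert j S hj ih =>
    have ih' := ih fun i hi => ha i (Finset.mem_insert_of_mem hi)
    have hj' := ha j (Finset.mem_insert_self j S)
    rw [Finset.sum_insert hj]
    filter_upwards [ih', hj', Lp.coeFn_add ((s j • a j : E.domain) : Lp ℝ 2 μ)
      ((∑ i ∈ S, s i • a i : E.domain) : Lp ℝ 2 μ), Lp.coeFn_smul (s j) (a j : Lp ℝ 2 μ)]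
      with x h1 h2 h3 h4
    rw [Finset.sum_insert hj, Submodule.coe_add, h3, Pi.add_apply, h1, Submodule.coe_smul, h4,
      Pi.smul_apply, h2, smul_eq_mul]

/-- Normal contraction by truncation at a positive level. -/
theorem exists_inf_const (E : DirichletForm μ) (v : E.domain) (hv : 0 ≤ (v : Lp ℝ 2 μ)) {c : ℝ}
    (hc : 0 < c) : ∃ g : E.domain, E.form g g ≤ E.form v v ∧
      ((g : Lp ℝ 2 μ) : M → ℝ) =ᵐ[μ] fun x => min (((v : Lp ℝ 2 μ) : M → ℝ) x) c := by
  have hpos : 0 ≤ ((c⁻¹ • v : E.domain) : Lp ℝ 2 μ) := by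
    rw [← Lp.coeFn_nonneg]
    filter_upwards [(Lp.coeFn_nonneg _).2 hv, Lp.coeFn_smul c⁻¹ (v : Lp ℝ 2 μ)] with x h1 h2
    rw [Submodule.coe_smul, h2]
    exact mul_nonneg (inv_nonneg.2 hc.le) h1
  obtain ⟨h, hle⟩ := E.inf_one_contraction (c⁻¹ • v) hpos
  refine ⟨c • ⟨_, h⟩, ?_, ?_⟩
  · simp only [map_smul, LinearMap.smul_apply, smul_eq_mul] at hle ⊢
    calc _ ≤ c * (c * (c⁻¹ * (c⁻¹ * E.form v v))) := by gcongr
      _ = E.form v v := by field_simp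
  · filter_upwards [Lp.coeFn_smul c (((c⁻¹ • v : E.domain) : Lp ℝ 2 μ) ⊓ Lp.const 2 μ (1 : ℝ)),
      Lp.coeFn_inf ((c⁻¹ • v : E.domain) : Lp ℝ 2 μ) (Lp.const 2 μ (1 : ℝ)),
      Lp.coeFn_smul c⁻¹ (v : Lp ℝ 2 μ), Lp.coeFn_const (μ := μ) (p := 2) (1 : ℝ)] with x h1 h2 h3 h4
    rw [Submodule.coe_smul, h1, Pi.smul_apply, h2, Pi.inf_apply, Submodule.coe_smul, h3, h4,
      Pi.smul_apply, smul_eq_mul, smul_eq_mul, Function.const_apply, mul_min_of_nonneg _ _ hc.le,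
      mul_inv_cancel_left₀ hc.ne', mul_one]

/-- The level `c = 0` is needed because the first dyadic level is `2^0 - 1 = 0`. -/
theorem exists_min_const (E : DirichletForm μ) (v : E.domain) (hv : 0 ≤ (v : Lp ℝ 2 μ)) {c : ℝ}
    (hc : 0 ≤ c) : ∃ g : E.domain,
      ((g : Lp ℝ 2 μ) : M → ℝ) =ᵐ[μ] fun x => min (((v : Lp ℝ 2 μ) : M → ℝ) x) c := by
  rcases hc.eq_or_lt with rfl | hc
  · refine ⟨0, ?_⟩
    filter_upwards [(Lp.coeFn_nonneg _).2 hv, Lp.coeFn_zero ℝ 2 μ] with x h1 h2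
    rw [Submodule.coe_zero, h2]
    exact (min_eq_right h1).symm
  · obtain ⟨g, -, hg⟩ := E.exists_inf_const v hv hc
    exact ⟨g, hg⟩

/-- If `w` lives where `v` has reached its maximum `c`, then `ℰ(v, w) ≥ 0`. -/
theorem form_nonneg_of_layers (E : DirichletForm μ) (v w : E.domain) {c : ℝ} (hc : 0 < c)
    (h : ∀ᵐ x ∂μ, 0 ≤ ((v : Lp ℝ 2 μ) : M → ℝ) x ∧ ((v : Lp ℝ 2 μ) : M → ℝ) x ≤ c ∧
      0 ≤ ((w : Lp ℝ 2 μ) : M → ℝ) x ∧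
      (((v : Lp ℝ 2 μ) : M → ℝ) x = c ∨ ((w : Lp ℝ 2 μ) : M → ℝ) x = 0)) :
    0 ≤ E.form v w := by
  have key : ∀ r : ℝ, 0 < r → 0 ≤ 2 * E.form v w + r * E.form w w := by
    intro r hr
    have hcoe : (((v + r • w : E.domain) : Lp ℝ 2 μ) : M → ℝ) =ᵐ[μ]
        fun x => ((v : Lp ℝ 2 μ) : M → ℝ) x + r * ((w : Lp ℝ 2 μ) : M → ℝ) x := by
      filter_upwards [Lp.coeFn_add (v : Lp ℝ 2 μ) ((r • w : E.domain) : Lp ℝ 2 μ),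
        Lp.coeFn_smul r (w : Lp ℝ 2 μ)] with x h1 h2
      rw [Submodule.coe_add, h1, Pi.add_apply, Submodule.coe_smul, h2, Pi.smul_apply, smul_eq_mul]
    have hpos : 0 ≤ ((v + r • w : E.domain) : Lp ℝ 2 μ) := by
      rw [← Lp.coeFn_nonneg]
      filter_upwards [hcoe, h] with x h1 h2
      rw [h1]
      exact add_nonneg h2.1 (mul_nonneg hr.le h2.2.2.1)
    -- Truncating `v + r w` at `c` returns `v`, hence `ℰ(v) ≤ ℰ(v + r w)`; expanding and dividing by
    -- `r` gives `key`.
    obtain ⟨g, hle, hg⟩ := E.exists_inf_const _ hpos hc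
    have hgv : g = v := by
      refine Subtype.ext (Lp.ext ?_)
      filter_upwards [hg, hcoe, h] with x h1 h2 ⟨h3, h4, h5, h6⟩
      rw [h1, h2]
      rcases h6 with h6 | h6
      · rw [h6]
        exact min_eq_right (le_add_of_nonneg_right (mul_nonneg hr.le h5))
      · rw [h6, mul_zero, add_zero, min_eq_left h4]
    rw [hgv] at hle
    simp only [map_add, map_smul, LinearMap.add_apply, LinearMap.smul_apply, smul_eq_mul,
      E.symm w v] at hle
    have : 0 ≤ r * (2 * E.form v w + r * E.form w w) := by linarith
    exact nonneg_of_mul_nonneg_right this hr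
  by_contra! hneg
  have hw := E.nonneg w
  have hd : 0 < E.form w w + 1 := by linarith
  -- This replaces the limit `r → 0`: for this `r` the term `r ℰ(w)` is at most `-ℰ(v, w)`, and the
  -- `+ 1` keeps the denominator positive.
  have h1 := key (-E.form v w / (E.form w w + 1)) (div_pos (neg_pos.2 hneg) hd)
  have h2 : -E.form v w / (E.form w w + 1) * E.form w w ≤ -E.form v w := by
    rw [div_mul_eq_mul_div, div_le_iff₀ hd]
    nlinarith
  linarith

/-- The discrete chain rule inequality `ℰ(ψ(u)) ≤ ℰ(u, φ(u))` for piecewise linear `ψ, φ` with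
`φ' = ψ'²`. -/
theorem exists_layerSum (E : DirichletForm μ) (u : E.domain) (hu : 0 ≤ (u : Lp ℝ 2 μ))
    (s : ℕ → ℝ) (n : ℕ) : ∃ w φ : E.domain,
      (((w : Lp ℝ 2 μ) : M → ℝ) =ᵐ[μ] fun x => layerSum s n (((u : Lp ℝ 2 μ) : M → ℝ) x)) ∧
      (((φ : Lp ℝ 2 μ) : M → ℝ) =ᵐ[μ]
        fun x => layerSum (fun i => s i ^ 2) n (((u : Lp ℝ 2 μ) : M → ℝ) x)) ∧
      E.form w w ≤ E.form u φ := by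
  have hτ (i : ℕ) : (0 : ℝ) ≤ 2 ^ i - 1 := sub_nonneg.2 (one_le_pow₀ one_le_two)
  have hτm {i j : ℕ} (h : i ≤ j) : (2 : ℝ) ^ i - 1 ≤ 2 ^ j - 1 :=
    sub_le_sub_right (pow_le_pow_right₀ one_le_two h) _
  choose g hg using fun i : ℕ => E.exists_min_const u hu (hτ i)
  set a : ℕ → E.domain := fun i => if i < n then g (i + 1) - g i else u - g i with ha
  set f : ℕ → M → ℝ := fun i x => if i < n
    then min (((u : Lp ℝ 2 μ) : M → ℝ) x) (2 ^ (i + 1) - 1)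
      - min (((u : Lp ℝ 2 μ) : M → ℝ) x) (2 ^ i - 1)
    else ((u : Lp ℝ 2 μ) : M → ℝ) x - min (((u : Lp ℝ 2 μ) : M → ℝ) x) (2 ^ i - 1) with hf
  have haf (i : ℕ) : ((a i : Lp ℝ 2 μ) : M → ℝ) =ᵐ[μ] f i := by
    by_cases hi : i < n
    · filter_upwards [Lp.coeFn_sub (g (i + 1) : Lp ℝ 2 μ) (g i : Lp ℝ 2 μ), hg i, hg (i + 1)]
        with x h1 h2 h3
      simp only [ha, hf, hi, if_true, Submodule.coe_sub]
      rw [h1, Pi.sub_apply, h2, h3]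
    · filter_upwards [Lp.coeFn_sub (u : Lp ℝ 2 μ) (g i : Lp ℝ 2 μ), hg i] with x h1 h2
      simp only [ha, hf, hi, if_false, Submodule.coe_sub]
      rw [h1, Pi.sub_apply, h2]
  have hlayer (r : ℕ → ℝ) : (((∑ i ∈ Finset.range (n + 1), r i • a i : E.domain) : Lp ℝ 2 μ)
      : M → ℝ) =ᵐ[μ] fun x => layerSum r n (((u : Lp ℝ 2 μ) : M → ℝ) x) := by
    refine (E.coeFn_sum_smul _ r a f fun i _ => haf i).trans (Eventually.of_forall fun x => ?_)
    simp only [Finset.sum_range_succ, layerSum, hf, lt_irrefl, if_false]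
    congr 1
    exact Finset.sum_congr rfl fun i hi => by rw [if_pos (Finset.mem_range.1 hi)]
  -- With all slopes equal to `1` the layers telescope back to `u`.
  have hsum : ∑ i ∈ Finset.range (n + 1), a i = u := by
    refine Subtype.ext (Lp.ext ?_)
    have h1 := hlayer fun _ => 1
    simp only [one_smul] at h1
    filter_upwards [h1, (Lp.coeFn_nonneg _).2 hu] with x h2 h3
    rw [h2, layerSum]
    simp only [one_mul]
    rw [Finset.sum_range_sub (fun i => min (((u : Lp ℝ 2 μ) : M → ℝ) x) ((2 : ℝ) ^ i - 1))]
    have : (0 : ℝ) ≤ ((u : Lp ℝ 2 μ) : M → ℝ) x := h3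
    simp [this]
  refine ⟨∑ i ∈ Finset.range (n + 1), s i • a i, ∑ i ∈ Finset.range (n + 1), s i ^ 2 • a i,
    hlayer s, hlayer _, ?_⟩
  have hmain := form_sum_smul_le E.form E.symm (Finset.range (n + 1)) a s ?_
  · rwa [hsum] at hmain
  intro i _ j hj hij
  -- The lower layer of a pair is never the unbounded top one, so it has a maximum, its height.
  -- Either `u` exceeds `2^(i+1) - 1` and layer `i` is full, or `u ≤ 2^(i+1) - 1 ≤ 2^j - 1` and
  -- layer `j` vanishes.
  have hin : i < n := by have := Finset.mem_range.1 hj; lia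
  refine E.form_nonneg_of_layers _ _ (c := (2 ^ (i + 1) - 1) - (2 ^ i - 1)) ?_ ?_
  · have : (0 : ℝ) < 2 ^ i := by positivity
    rw [pow_succ]; linarith
  filter_upwards [haf i, haf j, (Lp.coeFn_nonneg _).2 hu] with x h1 h2 h3
  have h3' : (0 : ℝ) ≤ ((u : Lp ℝ 2 μ) : M → ℝ) x := h3
  have hi1 := hτm i.le_succ
  have hj1 := hτm j.le_succ
  have hij1 := hτm (show i + 1 ≤ j from hij)
  rw [h1, h2]
  simp only [hf, hin, if_true]
  generalize ((u : Lp ℝ 2 μ) : M → ℝ) x = t at *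
  generalize (2 : ℝ) ^ (i + 1) - 1 = τ₁ at *
  generalize (2 : ℝ) ^ i - 1 = τ₀ at *
  generalize (2 : ℝ) ^ (j + 1) - 1 = τ₃ at *
  generalize (2 : ℝ) ^ j - 1 = τ₂ at *
  split_ifs <;> grind

end DirichletForm

/-! ### Hölder estimates for the critical nonlinearity -/

variable {M : Type*} [MeasurableSpace M] {μ : Measure M}

/-- Hölder with the conjugate exponents `(2+q)/q` and `(2+q)/2`. -/
theorem lintegral_rpow_mul_sq_le {q : ℝ} (hq : 0 < q) {h w : M → ℝ}
    (hh : AEStronglyMeasurable h μ) (hw : AEStronglyMeasurable w μ) :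
    ∫⁻ x, ‖h x‖ₑ ^ q * ‖w x‖ₑ ^ (2 : ℝ) ∂μ
      ≤ eLpNorm h (ENNReal.ofReal (2 + q)) μ ^ q * eLpNorm w (ENNReal.ofReal (2 + q)) μ ^ 2 := by
  have h2q : 0 < 2 + q := by linarith
  have hne : ENNReal.ofReal (2 + q) ≠ 0 := by simpa using h2q
  have hc : ((2 + q) / q).HolderConjugate ((2 + q) / 2) := by
    rw [Real.holderConjugate_iff]
    refine ⟨by rw [lt_div_iff₀ hq]; linarith, ?_⟩
    rw [inv_div, inv_div, ← add_div, add_comm q, div_self h2q.ne']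
  have key := ENNReal.lintegral_mul_le_Lp_mul_Lq μ hc (hh.enorm.pow_const q)
    (hw.enorm.pow_const (2 : ℝ))
  simp only [Pi.mul_apply, ← ENNReal.rpow_mul, mul_div_cancel₀ _ hq.ne',
    mul_div_cancel₀ _ (two_ne_zero (α := ℝ))] at key
  rw [eLpNorm_eq_lintegral_rpow_enorm_toReal hne ENNReal.ofReal_ne_top,
    eLpNorm_eq_lintegral_rpow_enorm_toReal hne ENNReal.ofReal_ne_top,
    ENNReal.toReal_ofReal h2q.le, ← ENNReal.rpow_natCast, ← ENNReal.rpow_mul, ← ENNReal.rpow_mul]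
  convert key using 3 <;> field_simp
  norm_num

/-- Splitting `|f|^q` with `f ∈ L^{2+q}` into a bounded part and a part that is small in
`L^{(2+q)/q}`. -/
theorem exists_lintegral_rpow_mul_sq_le {q : ℝ} (hq : 0 < q) {f : M → ℝ}
    (hfm : StronglyMeasurable f) (hf : MemLp f (ENNReal.ofReal (2 + q)) μ) {δ : ℝ} (hδ : 0 < δ) :
    ∃ Λ : ℝ, 0 ≤ Λ ∧ ∀ w : M → ℝ, AEStronglyMeasurable w μ →
      ∫⁻ x, ‖f x‖ₑ ^ q * ‖w x‖ₑ ^ (2 : ℝ) ∂μ ≤ ENNReal.ofReal Λ * eLpNorm w 2 μ ^ 2 +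
        ENNReal.ofReal δ * eLpNorm w (ENNReal.ofReal (2 + q)) μ ^ 2 := by
  -- The tail of `f` above `T` has `L^{2+q}` norm at most `δ^{1/q}`, whose `q`-th power in Hölder's
  -- inequality is `δ`.
  obtain ⟨T, hT⟩ := hf.eLpNorm_indicator_norm_ge_le hfm (ε := δ ^ q⁻¹) (by positivity)
  set h : M → ℝ := {x | T ≤ ‖f x‖₊}.indicator f with hh
  have hhm : StronglyMeasurable h := by
    refine hfm.indicator ?_
    exact measurableSet_le measurable_const hfm.nnnorm.measurable.subtype_coe
  refine ⟨max T 0 ^ q, by positivity, fun w hw => ?_⟩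
  have hpt (x : M) : ‖f x‖ₑ ^ q * ‖w x‖ₑ ^ (2 : ℝ) ≤
      ENNReal.ofReal (max T 0 ^ q) * ‖w x‖ₑ ^ (2 : ℝ) + ‖h x‖ₑ ^ q * ‖w x‖ₑ ^ (2 : ℝ) := by
    by_cases hx : T ≤ ‖f x‖₊
    · have : h x = f x := Set.indicator_of_mem (s := {x | T ≤ ‖f x‖₊}) hx f
      rw [this]
      exact le_add_self
    · refine le_add_right ?_
      gcongr
      rw [← ENNReal.ofReal_rpow_of_nonneg (le_max_right _ _) hq.le, ← ofReal_norm]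
      gcongr
      exact (not_le.1 hx).le.trans (le_max_left _ _)
  calc _ ≤ ∫⁻ x, (ENNReal.ofReal (max T 0 ^ q) * ‖w x‖ₑ ^ (2 : ℝ) + ‖h x‖ₑ ^ q * ‖w x‖ₑ ^ (2 : ℝ)) ∂μ :=
        lintegral_mono hpt
    _ = ENNReal.ofReal (max T 0 ^ q) * ∫⁻ x, ‖w x‖ₑ ^ (2 : ℝ) ∂μ
          + ∫⁻ x, ‖h x‖ₑ ^ q * ‖w x‖ₑ ^ (2 : ℝ) ∂μ := by
        rw [lintegral_add_left' ((hw.enorm.pow_const _).const_mul _),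
          lintegral_const_mul'' _ (hw.enorm.pow_const _)]
    _ ≤ _ := by
        gcongr
        · rw [eLpNorm_eq_lintegral_rpow_enorm_toReal two_ne_zero ENNReal.ofNat_ne_top,
            ← ENNReal.rpow_natCast, ← ENNReal.rpow_mul]
          simp
        · refine (lintegral_rpow_mul_sq_le hq hhm.aestronglyMeasurable hw).trans ?_
          gcongr
          calc _ ≤ ENNReal.ofReal (δ ^ q⁻¹) ^ q := by gcongr
            _ = ENNReal.ofReal δ := by
              rw [ENNReal.ofReal_rpow_of_nonneg (by positivity) hq.le, ← Real.rpow_mul hδ.le,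
                inv_mul_cancel₀ hq.ne', Real.rpow_one]

/-! ### Absorbing the potential and the nonlinearity -/

namespace DirichletForm

variable [IsFiniteMeasure μ]

/-- The test function inequality that absorbs the potential and the critical nonlinearity. -/
theorem IsNonnegYamabeSolution.exists_eLpNorm_le {E : DirichletForm μ} {V : M → ℝ} {ν A B : ℝ}
    (hν : 2 < ν) (hA : 0 < A) (hB : 0 < B) (hSob : E.SobolevInequality ν A B)
    (hV : Integrable V μ) (hVneg : E.InfinitesimallyFormBounded (fun x => max 0 (-V x)))
    {u : E.domain} (hu : E.IsNonnegYamabeSolution V ν u) {C : ℝ} (hC : 0 < C) :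
    ∃ K : ℝ, ∀ w φ : E.domain, φ ∈ E.schrodingerDomain V → 0 ≤ (φ : Lp ℝ 2 μ) →
      (∀ᵐ x ∂μ, ((u : Lp ℝ 2 μ) : M → ℝ) x * ((φ : Lp ℝ 2 μ) : M → ℝ) x
        ≤ C * ((w : Lp ℝ 2 μ) : M → ℝ) x ^ 2) →
      E.form w w ≤ E.form u φ →
      eLpNorm ((w : Lp ℝ 2 μ) : M → ℝ) (ENNReal.ofReal (2 * ν / (ν - 2))) μ ^ 2
        ≤ ENNReal.ofReal (K * ‖w‖ ^ 2) := by
  set Y := E.yamabeInvariant V ν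
  set q : ℝ := 4 / (ν - 2) with hq_def
  have hν' : 0 < ν - 2 := by linarith
  have hq : 0 < q := by positivity
  have h2q : 2 * ν / (ν - 2) = 2 + q := by rw [hq_def]; field_simp; ring
  have h1q : (ν + 2) / (ν - 2) = q + 1 := by rw [hq_def]; field_simp; ring
  have hufin : MemLp ((u : Lp ℝ 2 μ) : M → ℝ) (ENNReal.ofReal (2 + q)) μ := by
    refine ⟨Lp.aestronglyMeasurable _, ?_⟩
    have := (hSob u).trans_lt ENNReal.ofReal_lt_top
    rw [h2q] at this
    simpa using this
  -- This `ε` and the `δ` below are chosen so that the potential and the nonlinearity each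
  -- contribute at most `ℰ(w)/4`; the `+ 1` in `δ` covers `Y = 0`.
  obtain ⟨c, hc0, hc⟩ := hVneg (1 / (4 * C)) (by positivity)
  have hδ : 0 < 1 / (4 * C * A * (|Y| + 1)) := by positivity
  obtain ⟨Λ, hΛ0, hΛ⟩ := exists_lintegral_rpow_mul_sq_le hq
    (Lp.stronglyMeasurable (u : Lp ℝ 2 μ)) hufin hδ
  set δ := 1 / (4 * C * A * (|Y| + 1)) with hδ_def
  set K₀ : ℝ := C * c + |Y| * C * (Λ + δ * B)
  refine ⟨2 * A * K₀ + B, fun w φ hφ hφ0 hle hE => ?_⟩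
  set X := E.form w w with hX
  set N := ‖w‖ ^ 2 with hN
  have hX0 : 0 ≤ X := E.nonneg w
  have hN0 : 0 ≤ N := sq_nonneg _
  have hu0 := (Lp.coeFn_nonneg _).2 hu.nonneg
  have hφ0' := (Lp.coeFn_nonneg _).2 hφ0
  have hwm : AEStronglyMeasurable ((w : Lp ℝ 2 μ) : M → ℝ) μ := Lp.aestronglyMeasurable _
  have hum : AEStronglyMeasurable ((u : Lp ℝ 2 μ) : M → ℝ) μ := Lp.aestronglyMeasurable _
  have hφm : AEStronglyMeasurable ((φ : Lp ℝ 2 μ) : M → ℝ) μ := Lp.aestronglyMeasurable _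
  have hwN : eLpNorm ((w : Lp ℝ 2 μ) : M → ℝ) 2 μ ^ 2 = ENNReal.ofReal N := by
    rw [hN, ENNReal.ofReal_pow (norm_nonneg _), Submodule.coe_norm, Lp.norm_def,
      ENNReal.ofReal_toReal (Lp.eLpNorm_ne_top _)]
  have hSw := hSob w
  rw [h2q] at hSw ⊢
  -- the potential term
  have hVm : AEStronglyMeasurable (fun x => max 0 (-V x)) μ :=
    aestronglyMeasurable_const.sup hV.1.neg
  have hVw0 : 0 ≤ᵐ[μ] fun x => max 0 (-V x) * ((w : Lp ℝ 2 μ) : M → ℝ) x ^ 2 :=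
    Eventually.of_forall fun x => mul_nonneg (le_max_left _ _) (sq_nonneg _)
  have hVwm : AEStronglyMeasurable (fun x => max 0 (-V x) * ((w : Lp ℝ 2 μ) : M → ℝ) x ^ 2) μ :=
    hVm.mul (hwm.pow 2)
  have hVwi : Integrable (fun x => max 0 (-V x) * ((w : Lp ℝ 2 μ) : M → ℝ) x ^ 2) μ :=
    ⟨hVwm, (hasFiniteIntegral_iff_ofReal hVw0).2 ((hc w).trans_lt ENNReal.ofReal_lt_top)⟩
  have hVw : ∫ x, max 0 (-V x) * ((w : Lp ℝ 2 μ) : M → ℝ) x ^ 2 ∂μ ≤ 1 / (4 * C) * X + c * N := by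
    rw [integral_eq_lintegral_of_nonneg_ae hVw0 hVwm]
    exact ENNReal.toReal_le_of_le_ofReal (by positivity) (hc w)
  have hpot : -(C * (1 / (4 * C) * X + c * N)) ≤
      ∫ x, V x * ((u : Lp ℝ 2 μ) : M → ℝ) x * ((φ : Lp ℝ 2 μ) : M → ℝ) x ∂μ := by
    have h1 : ∫ x, -(V x * ((u : Lp ℝ 2 μ) : M → ℝ) x * ((φ : Lp ℝ 2 μ) : M → ℝ) x) ∂μ ≤
        ∫ x, C * (max 0 (-V x) * ((w : Lp ℝ 2 μ) : M → ℝ) x ^ 2) ∂μ := by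
      refine integral_mono_ae ?_ (hVwi.const_mul C) ?_
      -- `|V u φ| ≤ |V| u² + |V| φ²`, and both terms are integrable because `u` and `φ` lie in
      -- `𝒟(ℰ_V)`.
      · have hi := (hu.mem_domain.norm.add hφ.norm)
        refine (hi.mono ((hV.1.mul hum).mul hφm) ?_).neg
        refine Eventually.of_forall fun x => ?_
        simp only [Pi.add_apply, norm_mul, norm_pow, Real.norm_eq_abs, sq_abs, Pi.mul_apply]
        rw [abs_of_nonneg (by positivity : 0 ≤ |V x| * ((u : Lp ℝ 2 μ) : M → ℝ) x ^ 2
          + |V x| * ((φ : Lp ℝ 2 μ) : M → ℝ) x ^ 2), ← mul_add, mul_assoc]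
        gcongr
        rw [← sq_abs, ← sq_abs (((φ : Lp ℝ 2 μ) : M → ℝ) x)]
        nlinarith [sq_nonneg (|((u : Lp ℝ 2 μ) : M → ℝ) x| - |((φ : Lp ℝ 2 μ) : M → ℝ) x|),
          sq_nonneg (|((u : Lp ℝ 2 μ) : M → ℝ) x| + |((φ : Lp ℝ 2 μ) : M → ℝ) x|)]
      · filter_upwards [hle, hu0, hφ0'] with x h1 h2 h3
        have h4 : 0 ≤ ((u : Lp ℝ 2 μ) : M → ℝ) x * ((φ : Lp ℝ 2 μ) : M → ℝ) x := mul_nonneg h2 h3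
        -- Since `u φ ≥ 0`, the positive part of `V` can be dropped.
        calc _ = -V x * (((u : Lp ℝ 2 μ) : M → ℝ) x * ((φ : Lp ℝ 2 μ) : M → ℝ) x) := by ring
          _ ≤ max 0 (-V x) * (((u : Lp ℝ 2 μ) : M → ℝ) x * ((φ : Lp ℝ 2 μ) : M → ℝ) x) := by
            gcongr; exact le_max_right _ _
          _ ≤ max 0 (-V x) * (C * ((w : Lp ℝ 2 μ) : M → ℝ) x ^ 2) := by
            gcongr
          _ = _ := by ring
    rw [integral_neg, integral_const_mul] at h1
    have := mul_le_mul_of_nonneg_left hVw hC.le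
    linarith
  -- the nonlinear term
  have hS0 : 0 ≤ A * X + B * N := by positivity
  have hJ : ∫⁻ x, ‖((u : Lp ℝ 2 μ) : M → ℝ) x‖ₑ ^ q * ‖((w : Lp ℝ 2 μ) : M → ℝ) x‖ₑ ^ (2 : ℝ) ∂μ
      ≤ ENNReal.ofReal (Λ * N + δ * (A * X + B * N)) := by
    refine (hΛ _ hwm).trans ?_
    rw [hwN, ENNReal.ofReal_add (mul_nonneg hΛ0 hN0) (mul_nonneg hδ.le hS0), ENNReal.ofReal_mul hΛ0,
      ENNReal.ofReal_mul hδ.le]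
    gcongr
  have hJ0 : 0 ≤ᵐ[μ] fun x =>
      |((u : Lp ℝ 2 μ) : M → ℝ) x| ^ q * ((w : Lp ℝ 2 μ) : M → ℝ) x ^ 2 :=
    Eventually.of_forall fun x => by positivity
  have hJm : AEStronglyMeasurable (fun x =>
      |((u : Lp ℝ 2 μ) : M → ℝ) x| ^ q * ((w : Lp ℝ 2 μ) : M → ℝ) x ^ 2) μ :=
    ((hum.norm.aemeasurable.pow_const q).aestronglyMeasurable).mul (hwm.pow 2)
  have hJe : ∫⁻ x, ENNReal.ofReal
      (|((u : Lp ℝ 2 μ) : M → ℝ) x| ^ q * ((w : Lp ℝ 2 μ) : M → ℝ) x ^ 2) ∂μ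
      ≤ ENNReal.ofReal (Λ * N + δ * (A * X + B * N)) := by
    refine le_of_eq_of_le (lintegral_congr fun x => ?_) hJ
    rw [ENNReal.ofReal_mul (by positivity), ← ENNReal.ofReal_rpow_of_nonneg (abs_nonneg _) hq.le,
      ← sq_abs (((w : Lp ℝ 2 μ) : M → ℝ) x), ENNReal.ofReal_pow (abs_nonneg _),
      ← Real.enorm_eq_ofReal_abs, ← Real.enorm_eq_ofReal_abs, ENNReal.rpow_two]
  have hJi : Integrable (fun x =>
      |((u : Lp ℝ 2 μ) : M → ℝ) x| ^ q * ((w : Lp ℝ 2 μ) : M → ℝ) x ^ 2) μ :=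
    ⟨hJm, (hasFiniteIntegral_iff_ofReal hJ0).2 (hJe.trans_lt ENNReal.ofReal_lt_top)⟩
  have hJr : ∫ x, |((u : Lp ℝ 2 μ) : M → ℝ) x| ^ q * ((w : Lp ℝ 2 μ) : M → ℝ) x ^ 2 ∂μ
      ≤ Λ * N + δ * (A * X + B * N) := by
    rw [integral_eq_lintegral_of_nonneg_ae hJ0 hJm]
    exact ENNReal.toReal_le_of_le_ofReal (by positivity) hJe
  set I := ∫ x, ((u : Lp ℝ 2 μ) : M → ℝ) x ^ ((ν + 2) / (ν - 2)) *
    ((φ : Lp ℝ 2 μ) : M → ℝ) x ∂μ with hI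
  have hI0 : 0 ≤ I := by
    refine integral_nonneg_of_ae ?_
    filter_upwards [hu0, hφ0'] with x h1 h2
    exact mul_nonneg (Real.rpow_nonneg h1 _) h2
  have hIle : I ≤ C * (Λ * N + δ * (A * X + B * N)) := by
    refine le_trans ?_ (mul_le_mul_of_nonneg_left hJr hC.le)
    rw [← integral_const_mul]
    refine integral_mono_of_nonneg ?_ (hJi.const_mul C) ?_
    · filter_upwards [hu0, hφ0'] with x h1 h2
      exact mul_nonneg (Real.rpow_nonneg h1 _) h2
    · filter_upwards [hu0, hφ0', hle] with x h1 h2 h3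
      have h1' : 0 ≤ ((u : Lp ℝ 2 μ) : M → ℝ) x := h1
      calc _ = ((u : Lp ℝ 2 μ) : M → ℝ) x ^ q *
            (((u : Lp ℝ 2 μ) : M → ℝ) x * ((φ : Lp ℝ 2 μ) : M → ℝ) x) := by
            rw [h1q, Real.rpow_add_one' h1' (by linarith)]; ring
        _ ≤ ((u : Lp ℝ 2 μ) : M → ℝ) x ^ q * (C * ((w : Lp ℝ 2 μ) : M → ℝ) x ^ 2) := by gcongr
        _ = _ := by rw [abs_of_nonneg h1']; ring
  -- No sign of `Y` is known; `I ≥ 0` allows the passage to `|Y|`.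
  have hYI : Y * I ≤ |Y| * (C * (Λ * N + δ * (A * X + B * N))) :=
    (mul_le_mul_of_nonneg_right (le_abs_self Y) hI0).trans
      (mul_le_mul_of_nonneg_left hIle (abs_nonneg Y))
  have heq := hu.weak_eq φ hφ
  rw [schrodingerForm] at heq
  have e1 : C * (1 / (4 * C) * X) = X / 4 := by field_simp
  have e2 : |Y| * (C * (δ * (A * X))) ≤ X / 4 := by
    have : |Y| * (C * (δ * (A * X))) = |Y| / (|Y| + 1) * (X / 4) := by
      rw [hδ_def]; field_simp
    rw [this]
    refine mul_le_of_le_one_left (by positivity) ?_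
    rw [div_le_one (by positivity)]; linarith
  have hXN : X ≤ 2 * K₀ * N := by
    have : X ≤ X / 4 + X / 4 + K₀ * N := by
      calc X ≤ E.form u φ := hE
        _ ≤ Y * I + C * (1 / (4 * C) * X + c * N) := by linarith
        _ ≤ |Y| * (C * (Λ * N + δ * (A * X + B * N))) + C * (1 / (4 * C) * X + c * N) := by
          linarith
        _ = C * (1 / (4 * C) * X) + |Y| * (C * (δ * (A * X))) + K₀ * N := by ring
        _ ≤ _ := by rw [e1]; linarith
    linarith
  refine hSw.trans (ENNReal.ofReal_le_ofReal ?_)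
  have := mul_le_mul_of_nonneg_left hXN hA.le
  change A * X + B * N ≤ _
  linarith

end DirichletForm

/-! ### Passing to powers and to the limit -/

theorem memLp_rpow_of_nonneg {f : M → ℝ} (hfm : AEStronglyMeasurable f μ) (hf0 : 0 ≤ᵐ[μ] f)
    {γ r : ℝ} (hγ : 0 < γ) :
    MemLp (fun x => f x ^ γ) (ENNReal.ofReal r) μ ↔ MemLp f (ENNReal.ofReal (r * γ)) μ := by
  have h1 := memLp_norm_rpow_iff (p := ENNReal.ofReal (r * γ)) (q := ENNReal.ofReal γ) hfm
    (by simpa using hγ) ENNReal.ofReal_ne_top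
  rw [← ENNReal.ofReal_div_of_pos hγ, mul_div_cancel_right₀ _ hγ.ne',
    ENNReal.toReal_ofReal hγ.le] at h1
  rw [← h1]
  refine memLp_congr_ae ?_
  filter_upwards [hf0] with x hx
  rw [Real.norm_of_nonneg hx]

/-- Fatou's lemma: at each point the truncated functions are eventually constant in `n`, with value
`f (f/2)^β`, which is `2^{-β} f^{β+1}` where `f ≥ 0`. -/
theorem memLp_of_rpow_min_le {f : M → ℝ} (hfm : AEStronglyMeasurable f μ) (hf0 : 0 ≤ᵐ[μ] f)
    {β : ℝ} (hβ : 0 ≤ β) {p : ENNReal} {R : ENNReal} (hR : R < ⊤)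
    (h : ∀ n : ℕ, eLpNorm (fun x => f x * (min (f x) (2 ^ (n + 1) - 1) / 2) ^ β) p μ ≤ R) :
    MemLp (fun x => f x ^ (β + 1)) p μ := by
  have hmeas : AEStronglyMeasurable (fun x => f x * (f x / 2) ^ β) μ :=
    (hfm.aemeasurable.mul ((hfm.aemeasurable.div_const 2).pow_const β)).aestronglyMeasurable
  have hlim : eLpNorm (fun x => f x * (f x / 2) ^ β) p μ ≤ R := by
    refine (Lp.eLpNorm_lim_le_liminf_eLpNorm (f := fun (n : ℕ) x =>
      f x * (min (f x) (2 ^ (n + 1) - 1) / 2) ^ β) (fun n => ?_) _ ?_).trans ?_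
    · exact (hfm.aemeasurable.mul (((hfm.aemeasurable.min aemeasurable_const).div_const
        2).pow_const β)).aestronglyMeasurable
    · refine Eventually.of_forall fun x => tendsto_const_nhds.congr' ?_
      have htop : Tendsto (fun n : ℕ => (2 : ℝ) ^ (n + 1) - 1) atTop atTop :=
        tendsto_atTop_add_const_right _ _
          ((tendsto_pow_atTop_atTop_of_one_lt one_lt_two).comp (tendsto_add_atTop_nat 1))
      filter_upwards [htop.eventually_ge_atTop (f x)] with n hn
      rw [min_eq_left hn]
    · exact (liminf_le_liminf (Eventually.of_forall h)).trans (liminf_const R).le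
  have hmem : MemLp (fun x => f x * (f x / 2) ^ β) p μ := ⟨hmeas, hlim.trans_lt hR⟩
  refine (hmem.const_mul (2 ^ β)).ae_eq ?_
  filter_upwards [hf0] with x hx
  have hx' : 0 ≤ f x := hx
  rw [Real.rpow_add_one' hx' (by linarith), Real.div_rpow hx' zero_le_two]
  field_simp

/-! ### The iteration step -/

namespace DirichletForm

variable [IsFiniteMeasure μ]

/-- One step of the Moser iteration. -/
theorem IsNonnegYamabeSolution.memLp_step {E : DirichletForm μ} {V : M → ℝ} {ν A B : ℝ}
    (hν : 2 < ν) (hA : 0 < A) (hB : 0 < B) (hSob : E.SobolevInequality ν A B)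
    (hV : Integrable V μ) (hVneg : E.InfinitesimallyFormBounded (fun x => max 0 (-V x)))
    {u : E.domain} (hu : E.IsNonnegYamabeSolution V ν u) {γ : ℝ} (hγ : 1 ≤ γ)
    (hmem : MemLp ((u : Lp ℝ 2 μ) : M → ℝ) (ENNReal.ofReal (2 * γ)) μ) :
    MemLp ((u : Lp ℝ 2 μ) : M → ℝ) (ENNReal.ofReal (2 * ν / (ν - 2) * γ)) μ := by
  obtain ⟨β, hβ, rfl⟩ : ∃ β : ℝ, 0 ≤ β ∧ γ = β + 1 := ⟨γ - 1, by linarith, by ring⟩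
  have hum : AEStronglyMeasurable ((u : Lp ℝ 2 μ) : M → ℝ) μ := Lp.aestronglyMeasurable _
  have hu0 := (Lp.coeFn_nonneg _).2 hu.nonneg
  have hγ0 : 0 < β + 1 := by linarith
  have hs0 (i : ℕ) : 0 ≤ dyadicSlope β i := (dyadicSlope_pos β i).le
  have hm2 : Monotone fun i => dyadicSlope β i ^ 2 := fun i j h =>
    pow_le_pow_left₀ (hs0 i) (dyadicSlope_mono hβ h) 2
  obtain ⟨K, hK⟩ := hu.exists_eLpNorm_le hν hA hB hSob hV hVneg
    (C := 4 * (2 ^ β) ^ 2) (by positivity)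
  rw [← memLp_rpow_of_nonneg hum hu0 hγ0] at hmem ⊢
  rw [ENNReal.ofReal_ofNat] at hmem
  -- `G` dominates every `w` below, whatever `n` is, and lies in `L²` by `u ∈ L²` and the hypothesis
  -- on `u^{β+1}`.
  set G : M → ℝ := fun x => 2 ^ β * (((u : Lp ℝ 2 μ) : M → ℝ) x
    + ((u : Lp ℝ 2 μ) : M → ℝ) x ^ (β + 1)) with hG_def
  have hG : MemLp G 2 μ := ((Lp.memLp (u : Lp ℝ 2 μ)).add hmem).const_mul _
  set R : ENNReal := ENNReal.ofReal |K| ^ (1 / 2 : ℝ) * eLpNorm G 2 μ with hR_def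
  have hR : R < ⊤ :=
    ENNReal.mul_lt_top (ENNReal.rpow_lt_top_of_nonneg (by norm_num) ENNReal.ofReal_ne_top) hG.2
  refine memLp_of_rpow_min_le hum hu0 hβ
    (R := ENNReal.ofReal (2 * 2 ^ β) * R) (ENNReal.mul_lt_top ENNReal.ofReal_lt_top hR) fun n => ?_
  obtain ⟨w, φ, hw, hφ, hwφ⟩ := E.exists_layerSum u hu.nonneg (dyadicSlope β) n
  have hφ0 : 0 ≤ (φ : Lp ℝ 2 μ) := by
    rw [← Lp.coeFn_nonneg]
    filter_upwards [hφ, hu0] with x h1 h2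
    rw [h1]
    exact layerSum_nonneg (fun i => sq_nonneg _) hm2 n h2
  -- The largest slope of `φ` is finite, so `φ ≤ s_n² u` and `φ` inherits the integrability of `V
  -- u²`. The bound depends on `n`, but only membership is used.
  have hφV : φ ∈ E.schrodingerDomain V := by
    refine ((hu.mem_domain.const_mul ((dyadicSlope β n ^ 2) ^ 2)).mono
      (hV.1.mul ((Lp.aestronglyMeasurable (φ : Lp ℝ 2 μ)).pow 2)) ?_ : Integrable _ μ)
    simp only [Pi.mul_apply, Pi.pow_apply]
    filter_upwards [hφ, hu0] with x h1 h2
    have h3 := layerSum_le hm2 n h2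
    have h4 := layerSum_nonneg (fun i => sq_nonneg _) hm2 n h2
    rw [norm_mul, norm_mul, norm_mul, h1, Real.norm_of_nonneg (sq_nonneg _),
      Real.norm_of_nonneg (sq_nonneg (dyadicSlope β n ^ 2)), Real.norm_of_nonneg (sq_nonneg _)]
    calc _ ≤ ‖V x‖ * (dyadicSlope β n ^ 2 * ((u : Lp ℝ 2 μ) : M → ℝ) x) ^ 2 := by gcongr
      _ = _ := by ring
  have hest := hK w φ hφV hφ0 (by
    filter_upwards [hw, hφ, hu0] with x h1 h2 h3
    rw [h1, h2]
    exact mul_layerSum_sq_le hβ n h3) hwφ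
  have hwG : eLpNorm ((w : Lp ℝ 2 μ) : M → ℝ) 2 μ ≤ eLpNorm G 2 μ := by
    refine eLpNorm_mono_ae_real ?_
    filter_upwards [hw, hu0] with x h1 h2
    rw [h1, Real.norm_of_nonneg (layerSum_nonneg hs0 (dyadicSlope_mono hβ) n h2)]
    exact layerSum_le_rpow hβ n h2
  have hwR : eLpNorm ((w : Lp ℝ 2 μ) : M → ℝ) (ENNReal.ofReal (2 * ν / (ν - 2))) μ ≤ R := by
    have h1 : ENNReal.ofReal (K * ‖w‖ ^ 2) ≤ R ^ 2 := by
      calc _ ≤ ENNReal.ofReal (|K| * ‖w‖ ^ 2) :=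
            ENNReal.ofReal_le_ofReal (by gcongr; exact le_abs_self K)
        _ = ENNReal.ofReal |K| * eLpNorm ((w : Lp ℝ 2 μ) : M → ℝ) 2 μ ^ 2 := by
          rw [ENNReal.ofReal_mul (abs_nonneg _), ENNReal.ofReal_pow (norm_nonneg _),
            Submodule.coe_norm, Lp.norm_def, ENNReal.ofReal_toReal (Lp.eLpNorm_ne_top _)]
        _ ≤ ENNReal.ofReal |K| * eLpNorm G 2 μ ^ 2 := by gcongr
        _ = R ^ 2 := by
          rw [hR_def, mul_pow, ← ENNReal.rpow_natCast (_ ^ (1 / 2 : ℝ)), ← ENNReal.rpow_mul]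
          norm_num
    exact (ENNReal.pow_le_pow_left_iff two_ne_zero).1 (hest.trans h1)
  calc _ ≤ eLpNorm (fun x => 2 * 2 ^ β * ((w : Lp ℝ 2 μ) : M → ℝ) x)
        (ENNReal.ofReal (2 * ν / (ν - 2))) μ := by
        refine eLpNorm_mono_ae_real ?_
        filter_upwards [hw, hu0] with x h1 h2
        have h2' : 0 ≤ ((u : Lp ℝ 2 μ) : M → ℝ) x := h2
        have h3 : (0 : ℝ) ≤ min (((u : Lp ℝ 2 μ) : M → ℝ) x) (2 ^ (n + 1) - 1) :=
          le_min h2' (sub_nonneg.2 (one_le_pow₀ one_le_two))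
        rw [h1, Real.norm_of_nonneg (by positivity)]
        exact mul_rpow_le_layerSum hβ n h2
    _ = ENNReal.ofReal (2 * 2 ^ β) *
        eLpNorm ((w : Lp ℝ 2 μ) : M → ℝ) (ENNReal.ofReal (2 * ν / (ν - 2))) μ := by
        have := eLpNorm_const_smul (2 * 2 ^ β : ℝ) ((w : Lp ℝ 2 μ) : M → ℝ)
          (ENNReal.ofReal (2 * ν / (ν - 2))) μ
        rw [Real.enorm_of_nonneg (by positivity)] at this
        exact this
    _ ≤ _ := by gcongr

end DirichletForm

end DirichletYamabe

/-! ### Conclusion by iteration -/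

theorem mainTheorem7 {M : Type*} [TopologicalSpace M] [CompactSpace M] [MeasurableSpace M]
    [BorelSpace M] (μ : Measure M) [IsFiniteMeasure μ] [μ.Regular]
    (E : DirichletYamabe.DirichletForm μ) (hreg : E.IsRegular) (hloc : E.IsStronglyLocal)
    (ν A B : ℝ) (hν : 2 < ν) (hA : 0 < A) (hB : 0 < B) (hSob : E.SobolevInequality ν A B)
    (V : M → ℝ) (hV : Integrable V μ)
    (hVneg : E.InfinitesimallyFormBounded (fun x => max 0 (-V x)))
    (u : E.domain) (hu : E.IsNonnegYamabeSolution V ν u) (p : ℝ) (hp : 2 ≤ p) :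
    ∫⁻ x, ENNReal.ofReal (((u : Lp ℝ 2 μ) : M → ℝ) x ^ p) ∂μ < ⊤ := by
  have hu0 := (Lp.coeFn_nonneg _).2 hu.nonneg
  have hν' : 0 < ν - 2 := by linarith
  have hσ : 1 < ν / (ν - 2) := by rw [one_lt_div hν']; linarith
  -- The step is applied with `γ = σ^k`, where `σ = ν/(ν-2)`; it turns the exponent `2σ^k` into `2σ
  -- · σ^k`.
  have hiter (k : ℕ) : MemLp ((u : Lp ℝ 2 μ) : M → ℝ)
      (ENNReal.ofReal (2 * (ν / (ν - 2)) ^ k)) μ := by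
    induction k with
    | zero => simpa using Lp.memLp (u : Lp ℝ 2 μ)
    | succ k ih =>
      have := hu.memLp_step hν hA hB hSob hV hVneg (one_le_pow₀ hσ.le) ih
      convert! this using 2
      rw [pow_succ]
      ring
  obtain ⟨k, hk⟩ := pow_unbounded_of_one_lt p hσ
  have hp0 : 0 < p := by linarith
  -- As `μ` is finite, integrability at the exponent `2σ^k > p` passes down to `p`.
  have hmem : MemLp ((u : Lp ℝ 2 μ) : M → ℝ) (ENNReal.ofReal p) μ :=
    (hiter k).mono_exponent (ENNReal.ofReal_le_ofReal (by linarith))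
  have h1 : MemLp (fun x => ((u : Lp ℝ 2 μ) : M → ℝ) x ^ p) (ENNReal.ofReal 1) μ := by
    rw [DirichletYamabe.memLp_rpow_of_nonneg hmem.1 hu0 hp0, one_mul]
    exact hmem
  rw [ENNReal.ofReal_one, memLp_one_iff_integrable] at h1
  refine (hasFiniteIntegral_iff_ofReal ?_).1 h1.2
  filter_upwards [hu0] with x hx
  exact Real.rpow_nonneg hx p
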